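/- Let $1\le k\le d$ be integers, let $\mathcal X\subset\mathbb R^d$ be compact, and let $\mathcal M$ be the set of all probability measures on the Borel subsets of $\mathcal X$. For $\mu\in\mathcal M$ let $V_\mu$ be its covariance matrix, and for a symmetric $d\times d$ real matrix $V$ with eigenvalues $\lambda_1,\dots,\lambda_d$ (with multiplicity) put $$\Psi_k(V)=\frac{k+1}{k!}\sum_{i_1<\dots<i_k}\lambda_{i_1}\cdots\lambda_{i_k}.$$ Assume that $\Psi_k(V_\mu)>0$ for some $\mu\in\mathcal M$ (equivalently, $\mathcal X$ is not empty and is not contained in an affine subspace of dimension less than $k$). Then $$\max_{\mu\in\mathcal M}\Psi_k^{1/k}(V_\mu)=\min_{M,c\,:\ \mathcal X\subset\mathcal E(M,c)}\frac1{\phi_k^\infty(M)},$$ where both the maximum and the minimum are attained, the minimum is over all non-zero symmetric non-negative definite $d\times d$ matrices $M$ and all $c\in\mathbb R^d$ such that the ellipsoid $\mathcal E(M,c)=\{x\in\mathbb R^d:(x-c)^{\mathsf T}M(x-c)\le 1\}$ contains $\mathcal X$, and $\phi_k^\infty$ is the polar function $$\phi_k^\infty(M)=\inf_{V\succeq0,\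 \mathrm{tr}(MV)=1}\frac1{\Psi_k^{1/k}(V)}$$ (with $1/0=+\infty$ here and in $1/\phi_k^\infty(M)$). -/

import Mathlib

open MeasureTheory ProbabilityTheory Matrix
open scoped ENNReal Nat

noncomputable section

namespace GenVar

/-- The probability measures on the Borel subsets of `X`, seen as Borel probability measures on
`ℝ^d` that give no mass to the complement of `X`. -/
def probOn {d : ℕ} (X : Set (Fin d → ℝ)) : Set (Measure (Fin d → ℝ)) :=
  {μ | IsProbabilityMeasure μ ∧ μ Xᶜ = 0}

/-- The covariance matrix `V_μ` of a measure `μ` on `ℝ^d`. -/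
def covMat {d : ℕ} (μ : Measure (Fin d → ℝ)) : Matrix (Fin d) (Fin d) ℝ :=
  Matrix.of fun i j => cov[fun x => x i, fun x => x j; μ]

/-- The elementary symmetric function of degree `k` of the eigenvalues of `V`, where the
eigenvalues are counted with multiplicity, as roots of the characteristic polynomial
(a real symmetric matrix has all of its eigenvalues in `ℝ`, see `elemSym_eq_eigenvalues`). -/
def elemSym {d : ℕ} (k : ℕ) (V : Matrix (Fin d) (Fin d) ℝ) : ℝ :=
  V.charpoly.roots.esymm k

/-- For a symmetric matrix, `elemSym k V` is the sum, over the sets `s` of `k` indices, of the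
product of the eigenvalues indexed by `s`. -/
theorem elemSym_eq_eigenvalues {d : ℕ} (k : ℕ) {V : Matrix (Fin d) (Fin d) ℝ}
    (hV : V.IsHermitian) :
    elemSym k V = ∑ s ∈ Finset.powersetCard k Finset.univ, ∏ i ∈ s, hV.eigenvalues i := by
  rw [elemSym, hV.roots_charpoly_eq_eigenvalues, ← Finset.esymm_map_val]
  rfl

/-- The extended generalised variance `Ψ_k(V) = ((k + 1) / k!) E_k(V)`. -/
def Psi {d : ℕ} (k : ℕ) (V : Matrix (Fin d) (Fin d) ℝ) : ℝ :=
  ((k : ℝ) + 1) / (k ! : ℝ) * elemSym k V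

/-- `Ψ_k^{1/k}(V)`. -/
def PsiRoot {d : ℕ} (k : ℕ) (V : Matrix (Fin d) (Fin d) ℝ) : ℝ :=
  Psi k V ^ (1 / (k : ℝ))

/-- The polar function `φ_k^∞(M)`: the infimum of `1 / Ψ_k^{1/k}(V)` over `V ⪰ 0` with
`tr (M V) = 1`, taken in `[0, ∞]`, so that `1 / 0 = ∞`. -/
def polar {d : ℕ} (k : ℕ) (M : Matrix (Fin d) (Fin d) ℝ) : ℝ≥0∞ :=
  ⨅ V ∈ {V : Matrix (Fin d) (Fin d) ℝ | V.PosSemidef ∧ (M * V).trace = 1},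
    1 / ENNReal.ofReal (PsiRoot k V)

/-- The ellipsoid `{x | (x - c)ᵀ M (x - c) ≤ 1}`. -/
def ellipsoid {d : ℕ} (M : Matrix (Fin d) (Fin d) ℝ) (c : Fin d → ℝ) : Set (Fin d → ℝ) :=
  {x | (x - c) ⬝ᵥ (M *ᵥ (x - c)) ≤ 1}

end GenVar

end

noncomputable section

namespace GenVar

/-! The theorem is a strong duality whose dual solution is explicit: the normalised gradient at a
primal solution.

Weak duality: if `X` lies in the ellipsoid of `M` and `c`, integrating its inequality against `μ`
gives tr(M V_μ) ≤ 1. Since `PsiRoot` is monotone, V_μ can be enlarged until the trace is 1, so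
`PsiRoot k (covMat μ)` is at most `1 / polar k M` (`ofReal_PsiRoot_le`).

Equality: a maximiser μ exists by weak compactness. At A = V_μ there is M ⪰ 0 with tr(MA) = 1 and
Ψ_k^{1/k}(B) ≤ Ψ_k^{1/k}(A) tr(MB) for all B ⪰ 0 (`exists_PsiRoot_gradient`), so `1 / polar k M` is
the maximum. Moving a little mass to a point x of `X` cannot increase Ψ_k; to first order this puts
x in the ellipsoid of M centred at the mean (`subset_ellipsoid_of_isMax`).

The supergradient comes from superadditivity of e_k^{1/k} on the nonnegative orthant (Marcus–Lopes
and the geometric mean), carried over to matrices by Birkhoff's theorem. -/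

/-- The elementary symmetric polynomial of degree `k` in the variables `a i`, `i ∈ s`. -/
def esym {ι : Type*} (s : Finset ι) (k : ℕ) (a : ι → ℝ) : ℝ :=
  ∑ t ∈ s.powersetCard k, ∏ i ∈ t, a i

/-! ### Elementary symmetric polynomials on the nonnegative orthant. -/

section Vector

variable {ι : Type*}

theorem esym_nonneg {s : Finset ι} {k : ℕ} {a : ι → ℝ} (ha : 0 ≤ a) : 0 ≤ esym s k a :=
  Finset.sum_nonneg fun _ _ => Finset.prod_nonneg fun i _ => ha i

@[simp]
theorem esym_zero (s : Finset ι) (a : ι → ℝ) : esym s 0 a = 1 := by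
  simp [esym]

theorem esym_smul (s : Finset ι) (k : ℕ) (c : ℝ) (a : ι → ℝ) :
    esym s k (c • a) = c ^ k * esym s k a := by
  simp only [esym, Finset.mul_sum]
  refine Finset.sum_congr rfl fun t ht => ?_
  rw [Finset.mem_powersetCard] at ht
  simp [Finset.prod_mul_distrib, ht.2]

theorem esym_comp_perm [Fintype ι] (k : ℕ) (a : ι → ℝ) (σ : Equiv.Perm ι) :
    esym Finset.univ k (fun i => a (σ i)) = esym Finset.univ k a := by
  unfold esym
  refine Finset.sum_equiv (Equiv.finsetCongr σ) (fun t => ?_) (fun t _ => ?_)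
  · simp [Finset.mem_powersetCard]
  · simp

/-- The ratio of consecutive elementary symmetric polynomials. -/
def esymRatio (s : Finset ι) (k : ℕ) (a : ι → ℝ) : ℝ := esym s (k + 1) a / esym s k a

theorem esymRatio_nonneg {s : Finset ι} {k : ℕ} {a : ι → ℝ} (ha : 0 ≤ a) :
    0 ≤ esymRatio s k a :=
  div_nonneg (esym_nonneg ha) (esym_nonneg ha)

variable [DecidableEq ι]

/-- Pairs `(t, i)` with `i ∈ t ⊆ s` and `t` of size `k + 1`, enumerated by `i` first. -/
theorem sum_powersetCard_succ_erase (s : Finset ι) (k : ℕ) (F : ι → Finset ι → ℝ) :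
    ∑ t ∈ s.powersetCard (k + 1), ∑ i ∈ t, F i (t.erase i) =
      ∑ i ∈ s, ∑ u ∈ (s.erase i).powersetCard k, F i u := by
  rw [Finset.sum_sigma', Finset.sum_sigma']
  refine Finset.sum_bij' (fun p _ => ⟨p.2, p.1.erase p.2⟩) (fun q _ => ⟨insert q.1 q.2, q.1⟩)
    ?_ ?_ ?_ ?_ ?_
  · rintro ⟨t, i⟩ h
    simp only [Finset.mem_sigma, Finset.mem_powersetCard] at h ⊢
    exact ⟨h.1.1 h.2, Finset.erase_subset_erase _ h.1.1, by
      rw [Finset.card_erase_of_mem h.2, h.1.2]; rfl⟩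
  · rintro ⟨i, u⟩ h
    simp only [Finset.mem_sigma, Finset.mem_powersetCard] at h ⊢
    have hi : i ∉ u := fun hi => Finset.notMem_erase i s (h.2.1 hi)
    exact ⟨⟨Finset.insert_subset h.1 (h.2.1.trans (Finset.erase_subset _ _)), by
      rw [Finset.card_insert_of_notMem hi, h.2.2]⟩, Finset.mem_insert_self _ _⟩
  · rintro ⟨t, i⟩ h
    simp only [Finset.mem_sigma] at h
    simp [Finset.insert_erase h.2]
  · rintro ⟨i, u⟩ h
    simp only [Finset.mem_sigma, Finset.mem_powersetCard] at h
    have hi : i ∉ u := fun hi => Finset.notMem_erase i s (h.2.1 hi)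
    simp [Finset.erase_insert hi]
  · rintro ⟨t, i⟩ _
    rfl

theorem sum_mul_esym_erase (s : Finset ι) (k : ℕ) (a b : ι → ℝ) :
    ∑ i ∈ s, b i * esym (s.erase i) k a =
      ∑ t ∈ s.powersetCard (k + 1), ∑ i ∈ t, b i * ∏ j ∈ t.erase i, a j := by
  rw [sum_powersetCard_succ_erase s k fun i u => b i * ∏ j ∈ u, a j]
  simp [esym, Finset.mul_sum]

/-- Euler's identity for the elementary symmetric polynomials. -/
theorem sum_self_mul_esym_erase (s : Finset ι) (k : ℕ) (a : ι → ℝ) :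
    ∑ i ∈ s, a i * esym (s.erase i) k a = (k + 1) * esym s (k + 1) a := by
  rw [sum_mul_esym_erase, esym, Finset.mul_sum]
  refine Finset.sum_congr rfl fun t ht => ?_
  rw [Finset.mem_powersetCard] at ht
  rw [Finset.sum_congr rfl fun i hi => Finset.mul_prod_erase t a hi]
  simp [ht.2]

theorem esym_succ_eq_erase {s : Finset ι} {i : ι} (hi : i ∈ s) (k : ℕ) (a : ι → ℝ) :
    esym s (k + 1) a = esym (s.erase i) (k + 1) a + a i * esym (s.erase i) k a := by
  conv_lhs => rw [← Finset.insert_erase hi]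
  have hn : i ∉ s.erase i := Finset.notMem_erase i s
  unfold esym
  rw [Finset.powersetCard_succ_insert hn, Finset.sum_union, Finset.sum_image, Finset.mul_sum]
  · congr 1
    refine Finset.sum_congr rfl fun t ht => ?_
    rw [Finset.mem_powersetCard] at ht
    exact Finset.prod_insert fun h => hn (ht.1 h)
  · intro t ht u hu h
    rw [Finset.mem_coe, Finset.mem_powersetCard] at ht hu
    have h1 : i ∉ t := fun h => hn (ht.1 h)
    have h2 : i ∉ u := fun h => hn (hu.1 h)
    rw [← Finset.erase_insert h1, ← Finset.erase_insert h2, h]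
  · rw [Finset.disjoint_left]
    intro t ht h
    obtain ⟨u, -, rfl⟩ := Finset.mem_image.1 h
    exact hn ((Finset.mem_powersetCard.1 ht).1 (Finset.mem_insert_self i u))

/-- The parallel sum is superadditive on pairs of nonnegative numbers. -/
theorem parallel_superadd {x y z w : ℝ} (hx : 0 ≤ x) (hy : 0 ≤ y) (hz : 0 ≤ z) (hw : 0 ≤ w) :
    x * y / (x + y) + z * w / (z + w) ≤ (x + z) * (y + w) / ((x + z) + (y + w)) := by
  rcases (add_nonneg hx hy).eq_or_lt' with h | h
  · obtain rfl : x = 0 := by linarith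
    obtain rfl : y = 0 := by linarith
    simp
  rcases (add_nonneg hz hw).eq_or_lt' with h' | h'
  · obtain rfl : z = 0 := by linarith
    obtain rfl : w = 0 := by linarith
    simp
  rw [div_add_div _ _ h.ne' h'.ne', div_le_div_iff₀ (mul_pos h h') (by linarith)]
  -- With denominators cleared, the difference of the two sides is exactly this square.
  nlinarith [sq_nonneg (x * w - y * z)]

theorem parallel_mono {x y z : ℝ} (hx : 0 ≤ x) (hy : 0 ≤ y) (hyz : y ≤ z) :
    x * y / (x + y) ≤ x * z / (x + z) := by
  rcases (add_nonneg hx hy).eq_or_lt' with h | h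
  · rw [h, div_zero]
    exact div_nonneg (mul_nonneg hx (hy.trans hyz)) (add_nonneg hx (hy.trans hyz))
  rw [div_le_div_iff₀ h (by linarith)]
  nlinarith [mul_nonneg (mul_nonneg hx hx) (sub_nonneg.2 hyz)]

/-- Each product of k + 1 factors contains one of k factors, and those all vanish. This makes `0 / 0
= 0` harmless in `esymRatio`. -/
theorem esym_succ_eq_zero {s : Finset ι} {k : ℕ} {a : ι → ℝ} (ha : 0 ≤ a)
    (h : esym s k a = 0) : esym s (k + 1) a = 0 := by
  have h0 : ∀ t ∈ s.powersetCard k, ∏ i ∈ t, a i = 0 :=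
    (Finset.sum_eq_zero_iff_of_nonneg fun _ _ => Finset.prod_nonneg fun i _ => ha i).1 h
  refine Finset.sum_eq_zero fun t ht => ?_
  rw [Finset.mem_powersetCard] at ht
  obtain ⟨i, hi⟩ : t.Nonempty := Finset.card_pos.1 (by omega)
  rw [← Finset.mul_prod_erase t a hi, h0 (t.erase i), mul_zero]
  exact Finset.mem_powersetCard.2 ⟨(Finset.erase_subset _ _).trans ht.1, by
    rw [Finset.card_erase_of_mem hi, ht.2]; rfl⟩

/-- Since e_{k+1}(s) = e_{k+1}(s∖i) + a_i e_k(s∖i), each parallel sum equals a_i e_{k+1}(s∖i) /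
e_{k+1}(s), and Euler's identity adds these up. The recursion reduces superadditivity of the ratios
to that of the parallel sum. -/
theorem esymRatio_succ (s : Finset ι) (k : ℕ) {a : ι → ℝ} (ha : 0 ≤ a) :
    esymRatio s (k + 1) a =
      ((k : ℝ) + 2)⁻¹ * ∑ i ∈ s, a i * esymRatio (s.erase i) k a /
        (a i + esymRatio (s.erase i) k a) := by
  have key : ∀ i ∈ s, a i * esymRatio (s.erase i) k a / (a i + esymRatio (s.erase i) k a) =
      a i * esym (s.erase i) (k + 1) a / esym s (k + 1) a := by
    intro i hi
    rw [esym_succ_eq_erase hi, esymRatio]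
    rcases eq_or_ne (esym (s.erase i) k a) 0 with h | h
    · rw [esym_succ_eq_zero ha h, h]
      simp
    · have : a i + esym (s.erase i) (k + 1) a / esym (s.erase i) k a =
          (esym (s.erase i) (k + 1) a + a i * esym (s.erase i) k a) / esym (s.erase i) k a := by
        field_simp
        ring
      rw [this, mul_div_assoc', div_div_div_cancel_right₀ h]
  rw [Finset.sum_congr rfl key, ← Finset.sum_div, sum_self_mul_esym_erase, esymRatio]
  have : (k : ℝ) + 2 ≠ 0 := by positivity
  push_cast
  field_simp
  ring

/-- The Marcus–Lopes inequality. -/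
theorem esymRatio_superadd (k : ℕ) : ∀ (s : Finset ι) {a b : ι → ℝ}, 0 ≤ a → 0 ≤ b →
    esymRatio s k a + esymRatio s k b ≤ esymRatio s k (a + b) := by
  induction k with
  | zero =>
    intro s a b _ _
    simp [esymRatio, esym, Finset.powersetCard_one, Finset.sum_add_distrib]
  | succ k ih =>
    intro s a b ha hb
    rw [esymRatio_succ s k ha, esymRatio_succ s k hb, esymRatio_succ s k (add_nonneg ha hb),
      ← mul_add, ← Finset.sum_add_distrib]
    refine mul_le_mul_of_nonneg_left (Finset.sum_le_sum fun i _ => ?_) (by positivity)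
    have ga := esymRatio_nonneg (s := s.erase i) (k := k) ha
    have gb := esymRatio_nonneg (s := s.erase i) (k := k) hb
    exact (parallel_superadd (ha i) ga (hb i) gb).trans
      (parallel_mono (add_nonneg (ha i) (hb i)) (add_nonneg ga gb) (ih _ ha hb))

theorem esym_eq_prod_esymRatio (s : Finset ι) (k : ℕ) {a : ι → ℝ} (ha : 0 ≤ a) :
    esym s k a = ∏ j ∈ Finset.range k, esymRatio s j a := by
  induction k with
  | zero => simp
  | succ k ih =>
    rw [Finset.prod_range_succ, ← ih, esymRatio]
    rcases eq_or_ne (esym s k a) 0 with h | h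
    · rw [esym_succ_eq_zero ha h, h, zero_mul]
    · rw [mul_div_cancel₀ _ h]

/-- The geometric mean is superadditive. -/
theorem geom_mean_superadd {k : ℕ} (hk : k ≠ 0) {x y : ℕ → ℝ} (hx : ∀ j, 0 ≤ x j)
    (hy : ∀ j, 0 ≤ y j) :
    (∏ j ∈ Finset.range k, x j) ^ (1 / (k : ℝ)) + (∏ j ∈ Finset.range k, y j) ^ (1 / (k : ℝ)) ≤
      (∏ j ∈ Finset.range k, (x j + y j)) ^ (1 / (k : ℝ)) := by
  have hk' : (k : ℝ) ≠ 0 := Nat.cast_ne_zero.2 hk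
  by_cases h : ∀ j ∈ Finset.range k, 0 < x j + y j
  -- AM–GM for the ratios z_j / (x_j + y_j). For z = x and z = y the two arithmetic means add up to
  -- 1.
  · have amgm : ∀ z : ℕ → ℝ, (∀ j, 0 ≤ z j) →
        (∏ j ∈ Finset.range k, z j) ^ (1 / (k : ℝ)) ≤
          (∑ j ∈ Finset.range k, (1 / (k : ℝ)) * (z j / (x j + y j))) *
            (∏ j ∈ Finset.range k, (x j + y j)) ^ (1 / (k : ℝ)) := by
      intro z hz
      have := Real.geom_mean_le_arith_mean_weighted (Finset.range k) (fun _ => 1 / (k : ℝ))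
        (fun j => z j / (x j + y j)) (fun _ _ => by positivity) (by simp [hk'])
        (fun j hj => div_nonneg (hz j) (h j hj).le)
      rw [Real.finsetProd_rpow _ _ fun j hj => div_nonneg (hz j) (h j hj).le,
        Finset.prod_div_distrib, Real.div_rpow (Finset.prod_nonneg fun j _ => hz j)
        (Finset.prod_nonneg fun j hj => (h j hj).le)] at this
      rwa [div_le_iff₀ (Real.rpow_pos_of_pos (Finset.prod_pos h) _)] at this
    refine (add_le_add (amgm x hx) (amgm y hy)).trans_eq ?_
    rw [← add_mul, ← Finset.sum_add_distrib]
    have : ∑ j ∈ Finset.range k, ((1 / (k : ℝ)) * (x j / (x j + y j)) +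
        (1 / (k : ℝ)) * (y j / (x j + y j))) = 1 := by
      rw [Finset.sum_congr rfl fun j hj => by
        rw [← mul_add, ← add_div, div_self (h j hj).ne']]
      simp [hk']
    rw [this, one_mul]
  · push Not at h
    obtain ⟨j, hj, hle⟩ := h
    have hxj : x j = 0 := by linarith [hx j, hy j]
    have hyj : y j = 0 := by linarith [hx j, hy j]
    rw [Finset.prod_eq_zero hj hxj, Finset.prod_eq_zero hj hyj,
      Finset.prod_eq_zero hj (by rw [hxj, hyj, add_zero]), Real.zero_rpow (by simpa using hk)]
    simp

/-- `a ↦ e_k(a)^{1/k}` is superadditive on the nonnegative orthant. -/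
theorem esym_rpow_superadd (s : Finset ι) {k : ℕ} (hk : k ≠ 0) {a b : ι → ℝ} (ha : 0 ≤ a)
    (hb : 0 ≤ b) :
    esym s k a ^ (1 / (k : ℝ)) + esym s k b ^ (1 / (k : ℝ)) ≤
      esym s k (a + b) ^ (1 / (k : ℝ)) := by
  have hab := add_nonneg ha hb
  rw [esym_eq_prod_esymRatio s k ha, esym_eq_prod_esymRatio s k hb,
    esym_eq_prod_esymRatio s k hab]
  refine (geom_mean_superadd hk (fun _ => esymRatio_nonneg ha)
    (fun _ => esymRatio_nonneg hb)).trans ?_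
  refine Real.rpow_le_rpow (Finset.prod_nonneg fun j _ =>
    add_nonneg (esymRatio_nonneg ha) (esymRatio_nonneg hb)) ?_ (by positivity)
  exact Finset.prod_le_prod (fun j _ => add_nonneg (esymRatio_nonneg ha) (esymRatio_nonneg hb))
    fun j _ => esymRatio_superadd j s ha hb

theorem hasDerivAt_esym (s : Finset ι) (k : ℕ) (a b : ι → ℝ) :
    HasDerivAt (fun t : ℝ => esym s (k + 1) (a + t • b))
      (∑ i ∈ s, b i * esym (s.erase i) k a) 0 := by
  rw [sum_mul_esym_erase]
  unfold esym
  refine HasDerivAt.fun_sum fun t _ => ?_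
  have := HasDerivAt.fun_finsetProd (u := t) (f := fun i (r : ℝ) => (a + r • b) i)
    (f' := b) (x := (0 : ℝ)) fun i _ => by
      simpa using ((hasDerivAt_id (0 : ℝ)).mul_const (b i)).const_add (a i)
  refine this.congr_deriv (Finset.sum_congr rfl fun i _ => ?_)
  simp [mul_comm]

/-- The supporting hyperplane inequality for `e_k^{1/k}` at `a`. -/
theorem esym_gradient_inequality (s : Finset ι) (k : ℕ) {a b : ι → ℝ} (ha : 0 ≤ a) (hb : 0 ≤ b)
    (hpos : 0 < esym s (k + 1) a) :
    esym s (k + 1) b ^ (1 / ((k + 1 : ℕ) : ℝ)) ≤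
      esym s (k + 1) a ^ (1 / ((k + 1 : ℕ) : ℝ)) *
        ∑ i ∈ s, esym (s.erase i) k a / ((k + 1) * esym s (k + 1) a) * b i := by
  set p : ℝ := 1 / ((k + 1 : ℕ) : ℝ) with hp
  have hp0 : 0 < p := by positivity
  have hD := (hasDerivAt_esym s k a b).rpow_const (p := p) (Or.inl (by simpa using hpos.ne'))
  simp only [zero_smul, add_zero] at hD
  have hslope := hD.tendsto_slope_zero_right
  simp only [zero_add, zero_smul, add_zero] at hslope
  have hle : esym s (k + 1) b ^ p ≤
      (∑ i ∈ s, b i * esym (s.erase i) k a) * p * esym s (k + 1) a ^ (p - 1) := by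
    refine ge_of_tendsto hslope ?_
    -- Superadditivity and homogeneity of degree one give f(a) + t f(b) ≤ f(a + t b) for f =
    -- e_{k+1}^p, so f(b) is at most every difference quotient with t > 0.
    filter_upwards [self_mem_nhdsWithin] with t ht
    have ht : 0 < t := ht
    have h1 := esym_rpow_superadd s (Nat.succ_ne_zero k) ha (smul_nonneg ht.le hb)
    rw [esym_smul, Real.mul_rpow (by positivity) (esym_nonneg hb), Nat.succ_eq_add_one, ← hp,
      ← Real.rpow_natCast, ← Real.rpow_mul ht.le] at h1
    have : ((k + 1 : ℕ) : ℝ) * p = 1 := by rw [hp]; field_simp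
    rw [this, Real.rpow_one] at h1
    rw [smul_eq_mul, inv_mul_eq_div, le_div_iff₀ ht]
    linarith
  refine hle.trans_eq ?_
  rw [Real.rpow_sub_one hpos.ne', Finset.mul_sum, Finset.sum_mul, Finset.sum_mul]
  refine Finset.sum_congr rfl fun i _ => ?_
  rw [hp]
  push_cast
  field_simp

end Vector

/-! ### Characteristic polynomials and rank one perturbations. -/

section Coefficients

open Polynomial

theorem coeff_prod_X_sub_C {ι : Type*} (s : Finset ι) {k n : ℕ} (h : n + k = s.card)
    (a : ι → ℝ) : (∏ i ∈ s, (X - C (a i))).coeff n = (-1) ^ k * esym s k a := by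
  rw [← esym_smul]
  have := Finset.prod_X_add_C_coeff s (fun i => -a i) (k := n) (by omega)
  simp only [C_neg, ← sub_eq_add_neg] at this
  rw [this, ← h, Nat.add_sub_cancel_left, esym]
  simp

theorem elemSym_eq_coeff {d k : ℕ} (hkd : k ≤ d) {V : Matrix (Fin d) (Fin d) ℝ}
    (hV : V.IsHermitian) : elemSym k V = (-1) ^ k * V.charpoly.coeff (d - k) := by
  rw [hV.charpoly_eq, RCLike.ofReal_real_eq_id]
  simp only [id]
  rw [coeff_prod_X_sub_C _ (k := k) (by simp; omega), elemSym_eq_eigenvalues k hV, ← mul_assoc,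
    ← mul_pow]
  simp [esym]

theorem det_diagonal_add_vecMulVec {ι : Type*} [Fintype ι] [DecidableEq ι] {x : ι → ℝ}
    (hx : ∀ i, x i ≠ 0) (u v : ι → ℝ) :
    (diagonal x + vecMulVec u v).det =
      ∏ i, x i + ∑ i, u i * v i * ∏ j ∈ Finset.univ.erase i, x j := by
  have : diagonal x + vecMulVec u v = diagonal x *
      (1 + replicateCol Unit (fun i => u i / x i) * replicateRow Unit v) := by
    ext i j
    rw [mul_add, mul_one, Matrix.add_apply, Matrix.add_apply, diagonal_mul]
    simp only [vecMulVec_apply, mul_apply, replicateCol_apply, replicateRow_apply,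
      Finset.univ_unique, Finset.sum_const, Finset.card_singleton, one_smul]
    field_simp [hx i]
  rw [this, det_mul, det_diagonal, det_one_add_replicateCol_mul_replicateRow, mul_add, mul_one,
    dotProduct, Finset.mul_sum]
  congr 1
  refine Finset.sum_congr rfl fun i _ => ?_
  rw [← Finset.mul_prod_erase Finset.univ x (Finset.mem_univ i)]
  field_simp [hx i]

theorem charpoly_diagonal_add_vecMulVec {ι : Type*} [Fintype ι] [DecidableEq ι] (a u v : ι → ℝ) :
    (diagonal a + vecMulVec u v).charpoly =
      ∏ i, (X - C (a i)) - ∑ i, C (u i * v i) * ∏ j ∈ Finset.univ.erase i, (X - C (a j)) := by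
  refine Polynomial.eq_of_infinite_eval_eq _ _ ?_
  -- Away from the finitely many values a_i the diagonal part is invertible and the determinant
  -- formula applies.
  refine Set.Infinite.mono ?_ (Set.finite_range a).infinite_compl
  intro z hz
  have hz' : ∀ i, z - a i ≠ 0 := fun i h => hz ⟨i, by linarith⟩
  have h := det_diagonal_add_vecMulVec hz' (-u) v
  have h2 : scalar ι z - (diagonal a + vecMulVec u v) =
      diagonal (fun i => z - a i) + vecMulVec (-u) v := by
    ext i j
    by_cases hij : i = j <;> simp [hij, vecMulVec_apply, diagonal]; ring
  show eval z _ = eval z _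
  rw [eval_charpoly, h2, h]
  simp [eval_prod, eval_finsetSum, sub_eq_add_neg]

theorem elemSym_diagonal_add_vecMulVec {d k : ℕ} (hkd : k + 1 ≤ d) (a u : Fin d → ℝ) (t : ℝ) :
    elemSym (k + 1) (diagonal a + t • vecMulVec u u) =
      esym Finset.univ (k + 1) a +
        t * ∑ i, u i ^ 2 * esym (Finset.univ.erase i) k a := by
  have hH : (diagonal a + t • vecMulVec u u).IsHermitian := by
    ext i j
    by_cases hij : i = j
    · simp [hij]
    · simp [vecMulVec_apply, diagonal, hij, Ne.symm hij, mul_comm]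
  rw [elemSym_eq_coeff hkd hH, ← smul_vecMulVec, charpoly_diagonal_add_vecMulVec, coeff_sub,
    finsetSum_coeff, coeff_prod_X_sub_C _ (k := k + 1) (by simp; omega)]
  simp only [coeff_C_mul]
  rw [Finset.sum_congr rfl fun i hi => by
    rw [coeff_prod_X_sub_C (Finset.univ.erase i) (k := k)
      (by rw [Finset.card_erase_of_mem hi]; simp; omega)]]
  have e : ((-1 : ℝ) ^ k) * (-1) ^ k = 1 := by rw [← mul_pow]; simp
  rw [mul_sub, Finset.mul_sum, Finset.mul_sum, ← mul_assoc, pow_succ]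
  have : ((-1 : ℝ) ^ k * -1 * ((-1) ^ k * -1)) = 1 := by linear_combination e
  rw [this, one_mul, sub_eq_add_neg, ← Finset.sum_neg_distrib]
  congr 1
  refine Finset.sum_congr rfl fun i _ => ?_
  simp only [Pi.smul_apply, smul_eq_mul]
  linear_combination (t * u i ^ 2 * esym (Finset.univ.erase i) k a) * e

end Coefficients

/-! ### From eigenvalues to matrices: the supergradient. -/

section Spectral

variable {d : ℕ}

theorem elemSym_eq_esym (k : ℕ) {V : Matrix (Fin d) (Fin d) ℝ} (hV : V.IsHermitian) :
    elemSym k V = esym Finset.univ k hV.eigenvalues :=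
  elemSym_eq_eigenvalues k hV

theorem elemSym_conj (k : ℕ) {U : Matrix (Fin d) (Fin d) ℝ} (hU : star U * U = 1)
    (V : Matrix (Fin d) (Fin d) ℝ) : elemSym k (U * V * star U) = elemSym k V := by
  unfold elemSym
  rw [charpoly_mul_comm, ← mul_assoc, hU, one_mul]

theorem elemSym_nonneg (k : ℕ) {V : Matrix (Fin d) (Fin d) ℝ} (hV : V.PosSemidef) :
    0 ≤ elemSym k V := by
  rw [elemSym_eq_esym k hV.1]
  exact esym_nonneg hV.eigenvalues_nonneg

theorem elemSym_pos {k : ℕ} (hkd : k ≤ d) {V : Matrix (Fin d) (Fin d) ℝ} (hV : V.PosDef) :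
    0 < elemSym k V := by
  rw [elemSym_eq_esym k hV.1]
  exact Finset.sum_pos (fun t _ => Finset.prod_pos fun i _ => hV.eigenvalues_pos i)
    (Finset.powersetCard_nonempty.2 (by simpa using hkd))

theorem exists_diagonalization {V : Matrix (Fin d) (Fin d) ℝ} (hV : V.IsHermitian) :
    ∃ U : Matrix (Fin d) (Fin d) ℝ, star U * U = 1 ∧ U * star U = 1 ∧
      V = U * diagonal hV.eigenvalues * star U := by
  refine ⟨hV.eigenvectorUnitary, Unitary.coe_star_mul_self _, Unitary.coe_mul_star_self _, ?_⟩
  conv_lhs => rw [hV.spectral_theorem]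
  rfl

/-- A lower bound for a bilinear form over permutations passes to doubly stochastic matrices. -/
theorem le_dotProduct_mulVec_of_doublyStochastic {ι : Type*} [Fintype ι] [DecidableEq ι]
    {S : Matrix ι ι ℝ} (hS : S ∈ doublyStochastic ℝ ι) {m l : ι → ℝ} {c : ℝ}
    (h : ∀ σ : Equiv.Perm ι, c ≤ ∑ i, m i * l (σ i)) : c ≤ m ⬝ᵥ (S *ᵥ l) := by
  -- Birkhoff's theorem: `S` is a convex combination of permutation matrices.
  obtain ⟨w, hw, hw1, rfl⟩ := exists_eq_sum_perm_of_mem_doublyStochastic hS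
  have : m ⬝ᵥ ((∑ σ, w σ • Equiv.Perm.permMatrix ℝ σ) *ᵥ l) =
      ∑ σ, w σ * ∑ i, m i * l (σ i) := by
    rw [sum_mulVec, dotProduct_sum]
    refine Finset.sum_congr rfl fun σ _ => ?_
    rw [smul_mulVec, dotProduct_smul, permMatrix_mulVec]
    rfl
  rw [this]
  calc c = ∑ σ, w σ * c := by rw [← Finset.sum_mul, hw1, one_mul]
    _ ≤ _ := Finset.sum_le_sum fun σ _ => mul_le_mul_of_nonneg_left (h σ) (hw σ)

theorem sq_mem_doublyStochastic {ι : Type*} [Fintype ι] [DecidableEq ι] {Q : Matrix ι ι ℝ}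
    (h1 : star Q * Q = 1) (h2 : Q * star Q = 1) :
    (Matrix.of fun i j => Q i j ^ 2) ∈ doublyStochastic ℝ ι := by
  rw [mem_doublyStochastic_iff_sum]
  refine ⟨fun i j => sq_nonneg _, fun i => ?_, fun j => ?_⟩
  · have := congrFun (congrFun h2 i) i
    simpa [mul_apply, star_apply, sq] using this
  · have := congrFun (congrFun h1 j) j
    simpa [mul_apply, star_apply, sq] using this

theorem trace_conj_diagonal_mul (U : Matrix (Fin d) (Fin d) ℝ) (m : Fin d → ℝ)
    (B : Matrix (Fin d) (Fin d) ℝ) :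
    (U * diagonal m * star U * B).trace = ∑ i, m i * (star U * B * U) i i := by
  rw [mul_assoc, trace_mul_comm, ← mul_assoc, trace_mul_comm, trace]
  simp [diagonal_mul]

theorem conj_diagonal_apply_self (Q : Matrix (Fin d) (Fin d) ℝ) (l : Fin d → ℝ) (i : Fin d) :
    (Q * diagonal l * star Q) i i = ((Matrix.of fun i j => Q i j ^ 2) *ᵥ l) i := by
  rw [mul_apply]
  simp only [mul_diagonal, star_apply, mulVec, dotProduct, of_apply, star_trivial]
  exact Finset.sum_congr rfl fun j _ => by ring

/-- The supporting hyperplane of `e_{k+1}^{1/(k+1)}` at a positive semidefinite matrix `A`,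
together with the behaviour of `e_{k+1}` under rank one perturbations of `A`. -/
theorem exists_gradient {k : ℕ} (hkd : k + 1 ≤ d) {A : Matrix (Fin d) (Fin d) ℝ}
    (hA : A.PosSemidef) (hpos : 0 < elemSym (k + 1) A) :
    ∃ M : Matrix (Fin d) (Fin d) ℝ, M.PosSemidef ∧ (M * A).trace = 1 ∧
      (∀ B : Matrix (Fin d) (Fin d) ℝ, B.PosSemidef →
        elemSym (k + 1) B ^ (1 / ((k + 1 : ℕ) : ℝ)) ≤
          elemSym (k + 1) A ^ (1 / ((k + 1 : ℕ) : ℝ)) * (M * B).trace) ∧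
      ∀ (v : Fin d → ℝ) (t : ℝ), elemSym (k + 1) (A + t • vecMulVec v v) =
        elemSym (k + 1) A * (1 + t * ((k + 1) * (v ⬝ᵥ (M *ᵥ v)))) := by
  set a := hA.1.eigenvalues with hadef
  have ha : 0 ≤ a := hA.eigenvalues_nonneg
  obtain ⟨U, hU1, hU2, hUA⟩ := exists_diagonalization hA.1
  rw [← hadef] at hUA
  have hE : elemSym (k + 1) A = esym Finset.univ (k + 1) a := elemSym_eq_esym _ hA.1
  rw [hE] at hpos ⊢
  set e := esym Finset.univ (k + 1) a with he
  -- The gradient of log e_{k+1}^{1/(k+1)} at the eigenvalues of `A`; `M` carries it in an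
  -- eigenbasis of `A`, and Euler's identity gives tr(MA) = 1.
  set m : Fin d → ℝ := fun i => esym (Finset.univ.erase i) k a / ((k + 1) * e) with hm
  have hm0 : 0 ≤ m := fun i => div_nonneg (esym_nonneg ha) (by positivity)
  refine ⟨U * diagonal m * star U, ?_, ?_, ?_, ?_⟩
  · exact (PosSemidef.diagonal hm0).mul_mul_conjTranspose_same U
  · rw [trace_conj_diagonal_mul, hUA]
    have : star U * (U * diagonal a * star U) * U = diagonal a := by
      rw [← mul_assoc, ← mul_assoc, hU1, one_mul, mul_assoc, hU1, mul_one]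
    simp only [this, diagonal_apply_eq, hm]
    have h := sum_self_mul_esym_erase Finset.univ k a
    rw [← he] at h
    rw [Finset.sum_congr rfl fun i _ => by rw [div_mul_eq_mul_div, mul_comm], ← Finset.sum_div, h]
    exact div_self (by positivity)
  · intro B hB
    obtain ⟨W, hW1, hW2, hWB⟩ := exists_diagonalization hB.1
    set l := hB.1.eigenvalues with hl
    have hl0 : 0 ≤ l := hB.eigenvalues_nonneg
    rw [elemSym_eq_esym _ hB.1, ← hl, trace_conj_diagonal_mul]
    have hc : star U * B * U = (star U * W) * diagonal l * star (star U * W) := by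
      rw [hWB, star_mul, star_star]
      simp only [mul_assoc]
    -- In the eigenbasis of `A`, the diagonal of `B` is a doubly stochastic image of its spectrum.
    -- It thus suffices to treat permutations of that spectrum, which leave e_{k+1} unchanged.
    have hS := sq_mem_doublyStochastic (Q := star U * W)
      (by rw [star_mul, star_star, mul_assoc, ← mul_assoc U, hU2, one_mul, hW1])
      (by rw [star_mul, star_star, mul_assoc, ← mul_assoc W, hW2, one_mul, hU1])
    have hep : 0 < e ^ (1 / ((k + 1 : ℕ) : ℝ)) := Real.rpow_pos_of_pos hpos _
    rw [← div_le_iff₀' hep]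
    simp only [hc, conj_diagonal_apply_self]
    refine le_dotProduct_mulVec_of_doublyStochastic hS fun σ => ?_
    rw [div_le_iff₀' hep, ← esym_comp_perm (k + 1) l σ]
    exact esym_gradient_inequality Finset.univ k ha (fun i => hl0 (σ i)) hpos
  · intro v t
    have h1 : A + t • vecMulVec v v =
        U * (diagonal a + t • vecMulVec (star U *ᵥ v) (star U *ᵥ v)) * star U := by
      have : vecMulVec v v = U * vecMulVec (star U *ᵥ v) (star U *ᵥ v) * star U := by
        rw [mul_vecMulVec, vecMulVec_mul, mulVec_mulVec, hU2, one_mulVec]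
        congr 1
        rw [← mulVec_transpose, mulVec_mulVec]
        have : (star U)ᵀ = U := by ext; simp
        rw [this, hU2, one_mulVec]
      conv_lhs => rw [this, hUA]
      rw [mul_add, add_mul, Matrix.mul_smul, Matrix.smul_mul]
    have h2 : v ⬝ᵥ ((U * diagonal m * star U) *ᵥ v) = ∑ i, (star U *ᵥ v) i ^ 2 * m i := by
      rw [← mulVec_mulVec, ← mulVec_mulVec, dotProduct_mulVec, ← mulVec_transpose]
      have : Uᵀ = star U := by ext; simp
      rw [this, dotProduct]
      refine Finset.sum_congr rfl fun i _ => ?_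
      rw [mulVec_diagonal]
      ring
    rw [h1, elemSym_conj _ hU1, elemSym_diagonal_add_vecMulVec hkd, h2, ← he, mul_add, mul_one,
      Finset.mul_sum, Finset.mul_sum, Finset.mul_sum, Finset.mul_sum]
    congr 1
    refine Finset.sum_congr rfl fun i _ => ?_
    simp only [hm]
    field_simp

end Spectral

/-! ### Covariance matrices, ellipsoids and mixtures with a point mass. -/

section Covariance

variable {d : ℕ} {X : Set (Fin d → ℝ)} {μ : Measure (Fin d → ℝ)}

/-- The vector of means of the coordinates. -/
def meanVec (μ : Measure (Fin d → ℝ)) : Fin d → ℝ := fun i => ∫ x, x i ∂μ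

theorem ae_mem_of_mem_probOn (hμ : μ ∈ probOn X) : ∀ᵐ x ∂μ, x ∈ X :=
  hμ.2

theorem restrict_of_mem_probOn (hμ : μ ∈ probOn X) : μ.restrict X = μ :=
  Measure.restrict_eq_self_of_ae_mem (ae_mem_of_mem_probOn hμ)

theorem integrable_of_mem_probOn (hX : IsCompact X) (hμ : μ ∈ probOn X) {g : (Fin d → ℝ) → ℝ}
    (hg : Continuous g) : Integrable g μ := by
  have := hμ.1
  rw [← restrict_of_mem_probOn hμ]
  exact hg.continuousOn.integrableOn_compact hX

theorem memLp_of_mem_probOn (hX : IsCompact X) (hμ : μ ∈ probOn X) {g : (Fin d → ℝ) → ℝ}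
    (hg : Continuous g) : MemLp g 2 μ :=
  (memLp_two_iff_integrable_sq hg.aestronglyMeasurable).2
    (integrable_of_mem_probOn hX hμ (hg.pow 2))

theorem dirac_mem_probOn {x : Fin d → ℝ} (hx : x ∈ X) : Measure.dirac x ∈ probOn X := by
  refine ⟨inferInstance, ?_⟩
  simp [Measure.dirac_apply, hx]

/-- Covariances from the second moments about an arbitrary point `c`. -/
theorem covMat_apply_eq (hX : IsCompact X) (hμ : μ ∈ probOn X) (c : Fin d → ℝ) (i j : Fin d) :
    covMat μ i j = ∫ x, (x i - c i) * (x j - c j) ∂μ -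
      (meanVec μ i - c i) * (meanVec μ j - c j) := by
  have := hμ.1
  have hi : ∀ i, Integrable (fun x : Fin d → ℝ => x i) μ := fun i =>
    integrable_of_mem_probOn hX hμ (continuous_apply i)
  have hL : ∀ i, MemLp (fun x : Fin d → ℝ => x i - c i) 2 μ := fun i =>
    memLp_of_mem_probOn hX hμ ((continuous_apply i).sub continuous_const)
  have hm : ∀ i, ∫ x, (x i - c i) ∂μ = meanVec μ i - c i := fun i => by
    rw [integral_sub (hi i) (integrable_const _)]
    simp [meanVec]
  show cov[fun x => x i, fun x => x j; μ] = _
  rw [← covariance_sub_const_left (hi i) (c i), ← covariance_sub_const_right (hi j) (c j),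
    covariance_eq_sub (hL i) (hL j), hm, hm]
  rfl

theorem trace_mul_vecMulVec_self (Q : Matrix (Fin d) (Fin d) ℝ) (v : Fin d → ℝ) :
    (Q * vecMulVec v v).trace = v ⬝ᵥ (Q *ᵥ v) := by
  rw [mul_vecMulVec, trace_vecMulVec, dotProduct_comm]

theorem continuous_quadraticForm (Q : Matrix (Fin d) (Fin d) ℝ) (c : Fin d → ℝ) :
    Continuous fun x : Fin d → ℝ => (x - c) ⬝ᵥ (Q *ᵥ (x - c)) := by
  fun_prop

/-- The parallel axis identity; `c` is free so that it can be the centre of any ellipsoid. -/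
theorem trace_mul_covMat (hX : IsCompact X) (hμ : μ ∈ probOn X) (Q : Matrix (Fin d) (Fin d) ℝ)
    (c : Fin d → ℝ) :
    (Q * covMat μ).trace = ∫ x, (x - c) ⬝ᵥ (Q *ᵥ (x - c)) ∂μ -
      (meanVec μ - c) ⬝ᵥ (Q *ᵥ (meanVec μ - c)) := by
  have expand : ∀ v : Fin d → ℝ, v ⬝ᵥ (Q *ᵥ v) = ∑ i, ∑ j, Q i j * (v j * v i) := fun v => by
    simp only [dotProduct, mulVec, Finset.mul_sum]
    exact Finset.sum_congr rfl fun i _ => Finset.sum_congr rfl fun j _ => by ring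
  simp only [expand, Pi.sub_apply]
  have hint : ∀ i j, Integrable (fun x : Fin d → ℝ => Q i j * ((x j - c j) * (x i - c i))) μ :=
    fun i j => integrable_of_mem_probOn hX hμ (by fun_prop)
  rw [integral_finsetSum _ fun i _ => integrable_finsetSum _ fun j _ => hint i j]
  simp only [integral_finsetSum _ fun j _ => hint _ j, integral_const_mul]
  rw [trace, ← Finset.sum_sub_distrib]
  refine Finset.sum_congr rfl fun i _ => ?_
  rw [diag_apply, mul_apply, ← Finset.sum_sub_distrib]
  refine Finset.sum_congr rfl fun j _ => ?_
  rw [covMat_apply_eq hX hμ c, mul_sub]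

theorem covMat_posSemidef (hX : IsCompact X) (hμ : μ ∈ probOn X) : (covMat μ).PosSemidef := by
  refine PosSemidef.of_dotProduct_mulVec_nonneg ?_ fun v => ?_
  · ext i j
    exact covariance_comm _ _
  · have h := trace_mul_covMat hX hμ (vecMulVec v v) (meanVec μ)
    rw [trace_mul_comm, trace_mul_vecMulVec_self, sub_self, zero_dotProduct, sub_zero] at h
    rw [star_trivial, h]
    refine integral_nonneg fun x => ?_
    show 0 ≤ (x - meanVec μ) ⬝ᵥ (vecMulVec v v *ᵥ (x - meanVec μ))
    rw [vecMulVec_mulVec, op_smul_eq_smul, dotProduct_smul, smul_eq_mul,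
      dotProduct_comm _ v]
    exact mul_self_nonneg _

theorem trace_mul_covMat_le_one (hX : IsCompact X) (hμ : μ ∈ probOn X)
    {M : Matrix (Fin d) (Fin d) ℝ} (hM : M.PosSemidef) {c : Fin d → ℝ}
    (hc : X ⊆ ellipsoid M c) : (M * covMat μ).trace ≤ 1 := by
  have := hμ.1
  rw [trace_mul_covMat hX hμ M c]
  have h1 : ∫ x, (x - c) ⬝ᵥ (M *ᵥ (x - c)) ∂μ ≤ ∫ _, (1 : ℝ) ∂μ :=
    integral_mono_ae (integrable_of_mem_probOn hX hμ (continuous_quadraticForm M c))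
      (integrable_const _) ((ae_mem_of_mem_probOn hμ).mono fun x hx => hc hx)
  have h2 := hM.dotProduct_mulVec_nonneg (meanVec μ - c)
  rw [star_trivial] at h2
  simp only [integral_const, probReal_univ, smul_eq_mul, mul_one] at h1
  linarith

/-- The mixture of `μ` with the Dirac mass at `x`. -/
def mixDirac (μ : Measure (Fin d → ℝ)) (x : Fin d → ℝ) (t : ℝ) : Measure (Fin d → ℝ) :=
  ENNReal.ofReal (1 - t) • μ + ENNReal.ofReal t • Measure.dirac x

theorem mixDirac_mem_probOn (hμ : μ ∈ probOn X) {x : Fin d → ℝ} (hx : x ∈ X) {t : ℝ}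
    (h0 : 0 ≤ t) (h1 : t ≤ 1) : mixDirac μ x t ∈ probOn X := by
  have := hμ.1
  have hd := (dirac_mem_probOn hx).2
  refine ⟨⟨?_⟩, ?_⟩
  · simp only [mixDirac, Measure.add_apply, Measure.smul_apply, measure_univ, smul_eq_mul, mul_one]
    rw [← ENNReal.ofReal_add (by linarith) h0]
    simp
  · simp [mixDirac, hμ.2, hd]

theorem integral_mixDirac (hX : IsCompact X) (hμ : μ ∈ probOn X) {x : Fin d → ℝ} (hx : x ∈ X)
    {t : ℝ} (h0 : 0 ≤ t) (h1 : t ≤ 1) {g : (Fin d → ℝ) → ℝ} (hg : Continuous g) :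
    ∫ y, g y ∂(mixDirac μ x t) = (1 - t) * ∫ y, g y ∂μ + t * g x := by
  rw [mixDirac, integral_add_measure, integral_smul_measure, integral_smul_measure,
    integral_dirac, ENNReal.toReal_ofReal (by linarith), ENNReal.toReal_ofReal h0]
  · rfl
  · exact (integrable_of_mem_probOn hX hμ hg).smul_measure ENNReal.ofReal_ne_top
  · exact (integrable_of_mem_probOn hX (dirac_mem_probOn hx) hg).smul_measure
      ENNReal.ofReal_ne_top

theorem covMat_mixDirac (hX : IsCompact X) (hμ : μ ∈ probOn X) {x : Fin d → ℝ} (hx : x ∈ X)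
    {t : ℝ} (h0 : 0 ≤ t) (h1 : t ≤ 1) :
    covMat (mixDirac μ x t) =
      (1 - t) • (covMat μ + t • vecMulVec (x - meanVec μ) (x - meanVec μ)) := by
  have hm : ∀ i, meanVec (mixDirac μ x t) i = (1 - t) * meanVec μ i + t * x i := fun i =>
    integral_mixDirac hX hμ hx h0 h1 (continuous_apply i)
  ext i j
  rw [covMat_apply_eq hX (mixDirac_mem_probOn hμ hx h0 h1) (meanVec μ), hm, hm,
    integral_mixDirac hX hμ hx h0 h1 (by fun_prop), Matrix.smul_apply, Matrix.add_apply,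
    Matrix.smul_apply, covMat_apply_eq hX hμ (meanVec μ) i j]
  simp only [vecMulVec_apply, Pi.sub_apply, smul_eq_mul]
  ring

end Covariance

/-! ### Existence of a maximiser. -/

section Maximum

variable {d : ℕ} {X : Set (Fin d → ℝ)}

theorem continuous_charpoly_coeff (n : ℕ) :
    Continuous fun V : Matrix (Fin d) (Fin d) ℝ => V.charpoly.coeff n := by
  have h : (fun V : Matrix (Fin d) (Fin d) ℝ => V.charpoly.coeff n) = fun V =>
      MvPolynomial.eval (fun p : Fin d × Fin d => V p.1 p.2)
        ((charpoly.univ ℝ (Fin d)).coeff n) := by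
    ext V
    exact (charpoly.univ_coeff_eval₂Hom (Fin d) (RingHom.id ℝ)
      (fun p : Fin d × Fin d => V p.1 p.2) n).symm
  rw [h]
  exact (MvPolynomial.continuous_eval _).comp (by fun_prop)

theorem map_val_mem_probOn (hX : IsCompact X) (P : ProbabilityMeasure X) :
    (P : Measure X).map Subtype.val ∈ probOn X := by
  refine ⟨Measure.isProbabilityMeasure_map measurable_subtype_coe.aemeasurable, ?_⟩
  rw [Measure.map_apply measurable_subtype_coe hX.measurableSet.compl]
  simp

theorem exists_map_val_eq (hX : IsCompact X) {μ : Measure (Fin d → ℝ)} (hμ : μ ∈ probOn X) :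
    ∃ P : ProbabilityMeasure X, (P : Measure X).map Subtype.val = μ := by
  have h : (μ.comap Subtype.val : Measure X).map Subtype.val = μ := by
    rw [map_comap_subtype_coe hX.measurableSet, restrict_of_mem_probOn hμ]
  have := hμ.1
  refine ⟨⟨μ.comap Subtype.val, ⟨?_⟩⟩, h⟩
  rw [← Set.preimage_univ (f := (Subtype.val : X → Fin d → ℝ)),
    ← Measure.map_apply measurable_subtype_coe MeasurableSet.univ, h, measure_univ]

/-- Covariances are polynomials in first and second moments, which are integrals of functions
bounded on the compact `X`, hence weakly continuous. -/
theorem continuous_covMat_map_val (hX : IsCompact X) :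
    Continuous fun P : ProbabilityMeasure X => covMat ((P : Measure X).map Subtype.val) := by
  have := isCompact_iff_compactSpace.1 hX
  have hint : ∀ g : (Fin d → ℝ) → ℝ, Continuous g →
      Continuous fun P : ProbabilityMeasure X => ∫ x, g x ∂((P : Measure X).map Subtype.val) := by
    intro g hg
    have h := ProbabilityMeasure.continuous_integral_boundedContinuousFunction (X := X)
      (BoundedContinuousFunction.mkOfCompact ⟨fun x : X => g x, hg.comp continuous_subtype_val⟩)
    refine h.congr fun P => ?_
    rw [integral_map measurable_subtype_coe.aemeasurable hg.aestronglyMeasurable]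
    rfl
  refine continuous_matrix fun i j => ?_
  simp only [covMat_apply_eq hX (map_val_mem_probOn hX _) 0]
  simp only [Pi.zero_apply, sub_zero, meanVec]
  exact (hint _ (by fun_prop)).sub ((hint _ (by fun_prop)).mul (hint _ (by fun_prop)))

theorem exists_max_elemSym (hX : IsCompact X) (hne : (probOn X).Nonempty) {k : ℕ} (hkd : k ≤ d) :
    ∃ μ ∈ probOn X, ∀ ν ∈ probOn X, elemSym k (covMat ν) ≤ elemSym k (covMat μ) := by
  have := isCompact_iff_compactSpace.1 hX
  obtain ⟨μ₀, hμ₀⟩ := hne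
  obtain ⟨P₀, -⟩ := exists_map_val_eq hX hμ₀
  have hcont : Continuous fun P : ProbabilityMeasure X =>
      elemSym k (covMat ((P : Measure X).map Subtype.val)) := by
    -- As a coefficient of the characteristic polynomial, e_k is polynomial in the entries; no
    -- continuity of eigenvalues is needed.
    simp only [elemSym_eq_coeff hkd (covMat_posSemidef hX (map_val_mem_probOn hX _)).1]
    exact continuous_const.mul ((continuous_charpoly_coeff _).comp (continuous_covMat_map_val hX))
  obtain ⟨P, -, hP⟩ := isCompact_univ.exists_isMaxOn ⟨P₀, Set.mem_univ _⟩ hcont.continuousOn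
  refine ⟨_, map_val_mem_probOn hX P, fun ν hν => ?_⟩
  obtain ⟨N, rfl⟩ := exists_map_val_eq hX hν
  exact hP (Set.mem_univ N)

end Maximum

/-! ### Duality and first order optimality. -/

variable {d : ℕ}

theorem PsiRoot_eq (k : ℕ) {V : Matrix (Fin d) (Fin d) ℝ} (hV : V.PosSemidef) :
    PsiRoot k V =
      (((k : ℝ) + 1) / (k ! : ℝ)) ^ (1 / (k : ℝ)) * elemSym k V ^ (1 / (k : ℝ)) :=
  Real.mul_rpow (by positivity) (elemSym_nonneg k hV)

theorem elemSym_smul {k : ℕ} (hkd : k ≤ d) {V : Matrix (Fin d) (Fin d) ℝ} (hV : V.IsHermitian)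
    (c : ℝ) : elemSym k (c • V) = c ^ k * elemSym k V := by
  obtain ⟨U, hU, -, hUV⟩ := exists_diagonalization hV
  have hdiag : ∀ a : Fin d → ℝ, elemSym k (diagonal a) = esym Finset.univ k a := fun a => by
    rw [elemSym_eq_coeff hkd (isHermitian_diagonal a), charpoly_diagonal,
      coeff_prod_X_sub_C _ (k := k) (by simp; omega), ← mul_assoc, ← mul_pow]
    simp
  have h : c • V = U * diagonal (c • hV.eigenvalues) * star U := by
    conv_lhs => rw [hUV]
    rw [diagonal_smul, Matrix.mul_smul, Matrix.smul_mul]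
  rw [h, elemSym_conj k hU, hdiag, esym_smul, elemSym_eq_esym k hV]

theorem trace_mul_nonneg {M B : Matrix (Fin d) (Fin d) ℝ} (hM : M.PosSemidef)
    (hB : B.PosSemidef) : 0 ≤ (M * B).trace := by
  obtain ⟨U, -, -, hU⟩ := exists_diagonalization hM.1
  rw [hU, trace_conj_diagonal_mul]
  exact Finset.sum_nonneg fun i _ => mul_nonneg (hM.eigenvalues_nonneg i)
    (hB.conjTranspose_mul_mul_same U).diag_nonneg

/-- `Ψ_k^{1/k}` has, at any positive semidefinite `A` with `Ψ_k(A) > 0`, a positive semidefinite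
normalised supergradient. -/
theorem exists_PsiRoot_gradient {k : ℕ} (hk : 1 ≤ k) (hkd : k ≤ d)
    {A : Matrix (Fin d) (Fin d) ℝ} (hA : A.PosSemidef) (hpos : 0 < elemSym k A) :
    ∃ M : Matrix (Fin d) (Fin d) ℝ, M.PosSemidef ∧ (M * A).trace = 1 ∧
      (∀ B : Matrix (Fin d) (Fin d) ℝ, B.PosSemidef →
        PsiRoot k B ≤ PsiRoot k A * (M * B).trace) ∧
      ∀ (v : Fin d → ℝ) (t : ℝ), elemSym k (A + t • vecMulVec v v) =
        elemSym k A * (1 + t * (k * (v ⬝ᵥ (M *ᵥ v)))) := by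
  obtain ⟨k, rfl⟩ : ∃ j, k = j + 1 := ⟨k - 1, by omega⟩
  obtain ⟨M, hM, hMA, hsup, hrank⟩ := exists_gradient hkd hA hpos
  refine ⟨M, hM, hMA, fun B hB => ?_, fun v t => by rw [hrank]; push_cast; rfl⟩
  rw [PsiRoot_eq _ hB, PsiRoot_eq _ hA, mul_assoc]
  exact mul_le_mul_of_nonneg_left (hsup B hB) (by positivity)

/-- The supergradient `M` at the larger matrix `C` satisfies tr(MV) ≤ tr(MC) = 1. -/
theorem PsiRoot_le_of_sub {k : ℕ} (hk : 1 ≤ k) (hkd : k ≤ d) {V C : Matrix (Fin d) (Fin d) ℝ}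
    (hV : V.PosSemidef) (hC : C.PosSemidef) (hpos : 0 < elemSym k C) (h : (C - V).PosSemidef) :
    PsiRoot k V ≤ PsiRoot k C := by
  obtain ⟨M, hM, hMC, hsup, -⟩ := exists_PsiRoot_gradient hk hkd hC hpos
  have h0 : 0 ≤ PsiRoot k C := by rw [PsiRoot_eq k hC]; have := hpos.le; positivity
  have h1 := trace_mul_nonneg hM h
  rw [mul_sub, trace_sub, hMC] at h1
  exact (hsup V hV).trans (mul_le_of_le_one_right h0 (by linarith))

/-- Weak duality. -/
theorem ofReal_PsiRoot_le {k : ℕ} (hk : 1 ≤ k) (hkd : k ≤ d) {V M : Matrix (Fin d) (Fin d) ℝ}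
    (hV : V.PosSemidef) (hM : M.PosSemidef) (hM0 : M ≠ 0) (h : (M * V).trace ≤ 1) :
    ENNReal.ofReal (PsiRoot k V) ≤ 1 / polar k M := by
  have key : ∀ C : Matrix (Fin d) (Fin d) ℝ, C.PosSemidef → (M * C).trace = 1 →
      ENNReal.ofReal (PsiRoot k C) ≤ 1 / polar k M := by
    intro C hC hMC
    rw [one_div, ENNReal.le_inv_iff_le_inv, ← one_div]
    exact iInf₂_le C ⟨hC, hMC⟩
  rcases h.eq_or_lt with h | h
  · exact key V hV h
  have htr : 0 < M.trace :=
    hM.trace_nonneg.lt_of_ne fun h0 => hM0 (hM.trace_eq_zero_iff.1 h0.symm)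
  -- Adding r times the identity brings the trace to exactly 1, and makes the matrix positive
  -- definite so that monotonicity applies.
  set r := (1 - (M * V).trace) / M.trace with hr
  have hr0 : 0 < r := div_pos (by linarith) htr
  have hI : (r • (1 : Matrix (Fin d) (Fin d) ℝ)).PosDef := PosDef.one.smul hr0
  have hC : (V + r • (1 : Matrix (Fin d) (Fin d) ℝ)).PosDef := PosDef.posSemidef_add hV hI
  refine le_trans (ENNReal.ofReal_le_ofReal ?_) (key _ hC.posSemidef ?_)
  · refine PsiRoot_le_of_sub hk hkd hV hC.posSemidef (elemSym_pos hkd hC) ?_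
    rw [add_sub_cancel_left]
    exact hI.posSemidef
  · rw [mul_add, Matrix.mul_smul, mul_one, trace_add, trace_smul, smul_eq_mul, hr,
      div_mul_cancel₀ _ htr.ne']
    ring

/-- First order optimality for the covariance of a maximiser: the normalised gradient defines an
ellipsoid, centred at the mean, that contains `X`. -/
theorem subset_ellipsoid_of_isMax {k : ℕ} (hk : 1 ≤ k) (hkd : k ≤ d) {X : Set (Fin d → ℝ)}
    (hX : IsCompact X) {μ : Measure (Fin d → ℝ)} (hμ : μ ∈ probOn X)
    (hmax : ∀ ν ∈ probOn X, elemSym k (covMat ν) ≤ elemSym k (covMat μ))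
    (hpos : 0 < elemSym k (covMat μ)) {M : Matrix (Fin d) (Fin d) ℝ}
    (hrank : ∀ (v : Fin d → ℝ) (t : ℝ), elemSym k (covMat μ + t • vecMulVec v v) =
      elemSym k (covMat μ) * (1 + t * (k * (v ⬝ᵥ (M *ᵥ v))))) :
    X ⊆ ellipsoid M (meanVec μ) := by
  intro x hx
  show (x - meanVec μ) ⬝ᵥ (M *ᵥ (x - meanVec μ)) ≤ 1
  set v := x - meanVec μ with hv
  set q := v ⬝ᵥ (M *ᵥ v) with hq
  by_contra! hq1
  have hk0 : (0 : ℝ) < k := by exact_mod_cast hk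
  have bound : ∀ t : ℝ, 0 ≤ t → t ≤ 1 → (1 - k * t) * (1 + t * (k * q)) ≤ 1 := by
    intro t h0 h1
    have hH : (covMat μ + t • vecMulVec v v).IsHermitian :=
      (covMat_posSemidef hX hμ).1.add (by
        ext i j
        simp [vecMulVec_apply, mul_comm])
    have h := hmax _ (mixDirac_mem_probOn hμ hx h0 h1)
    rw [covMat_mixDirac hX hμ hx h0 h1, ← hv, elemSym_smul hkd hH, hrank, ← hq,
      mul_left_comm] at h
    have h2 := (mul_le_iff_le_one_right hpos).1 h
    -- Bernoulli's inequality bounds the loss from the factor 1 - t on the covariance of the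
    -- mixture.
    have h3 : 1 - k * t ≤ (1 - t) ^ k := by
      have := one_add_mul_le_pow (a := -t) (by linarith) k
      rw [← sub_eq_add_neg] at this
      linarith
    exact (mul_le_mul_of_nonneg_right h3 (by positivity)).trans h2
  have hkq : 0 < k * q := by positivity
  -- The left side of `bound` exceeds 1 for 0 < t < (q - 1)/(kq); this is the midpoint.
  set t := (q - 1) / (2 * (k * q)) with ht
  have ht0 : 0 < t := div_pos (by linarith) (by positivity)
  have htk : t * (2 * (k * q)) = q - 1 := div_mul_cancel₀ _ (by positivity)
  have hk1 : (1 : ℝ) ≤ k := by exact_mod_cast hk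
  have ht1 : t ≤ 1 := by
    rw [ht, div_le_one (by positivity)]
    nlinarith
  have hb := bound t ht0.le ht1
  have hexp : (1 - k * t) * (1 + t * (k * q)) = 1 + k * t * ((q - 1) - t * (k * q)) := by ring
  have hlt : 0 < k * t * ((q - 1) - t * (k * q)) := by
    refine mul_pos (by positivity) ?_
    linarith
  linarith

end GenVar

end

theorem theorem4 (d k : ℕ) (hk : 1 ≤ k) (hkd : k ≤ d)
    (X : Set (Fin d → ℝ)) (hX : IsCompact X)
    (hpos : ∃ μ ∈ GenVar.probOn X, 0 < GenVar.Psi k (GenVar.covMat μ)) :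
    ∃ m : ℝ,
      IsGreatest {r : ℝ | ∃ μ ∈ GenVar.probOn X, r = GenVar.PsiRoot k (GenVar.covMat μ)} m ∧
      IsLeast {r : ℝ≥0∞ | ∃ (M : Matrix (Fin d) (Fin d) ℝ) (c : Fin d → ℝ),
        M.PosSemidef ∧ M ≠ 0 ∧ X ⊆ GenVar.ellipsoid M c ∧ r = 1 / GenVar.polar k M}
        (ENNReal.ofReal m) := by
  obtain ⟨μ₀, hμ₀, hpos₀⟩ := hpos
  obtain ⟨μ, hμ, hmax⟩ := GenVar.exists_max_elemSym hX ⟨μ₀, hμ₀⟩ hkd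
  have hpos : 0 < GenVar.elemSym k (GenVar.covMat μ) :=
    (pos_of_mul_pos_right hpos₀ (by positivity)).trans_le (hmax μ₀ hμ₀)
  have hV := GenVar.covMat_posSemidef hX hμ
  obtain ⟨M, hM, hMV, hsup, hrank⟩ := GenVar.exists_PsiRoot_gradient hk hkd hV hpos
  have hM0 : M ≠ 0 := by
    rintro rfl
    simp at hMV
  refine ⟨GenVar.PsiRoot k (GenVar.covMat μ), ⟨⟨μ, hμ, rfl⟩, ?_⟩, ⟨M, GenVar.meanVec μ, hM, hM0,
    GenVar.subset_ellipsoid_of_isMax hk hkd hX hμ hmax hpos hrank, ?_⟩, ?_⟩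
  · rintro _ ⟨ν, hν, rfl⟩
    rw [GenVar.PsiRoot_eq k hV, GenVar.PsiRoot_eq k (GenVar.covMat_posSemidef hX hν)]
    have := GenVar.elemSym_nonneg k (GenVar.covMat_posSemidef hX hν)
    have := hmax ν hν
    gcongr
  · refine le_antisymm (GenVar.ofReal_PsiRoot_le hk hkd hV hM hM0 hMV.le) ?_
    rw [one_div, ENNReal.inv_le_iff_inv_le, ← one_div]
    -- For feasible `B`, tr(MB) = 1, so the supergradient inequality reads `PsiRoot k B ≤ PsiRoot k
    -- (covMat μ)`.
    refine le_iInf₂ fun B hB => ENNReal.div_le_div_left (ENNReal.ofReal_le_ofReal ?_) _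
    simpa [hB.2] using hsup B hB.1
  · rintro _ ⟨M', c, hM', hM0', hc, rfl⟩
    exact GenVar.ofReal_PsiRoot_le hk hkd hV hM' hM0'
      (GenVar.trace_mul_covMat_le_one hX hμ hM' hc)
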